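/- Let $d\ge 0$ and let $I_1,\dots,I_d\subset\mathbb R$ be intervals (bounded or unbounded), $\mathbf I=I_1\times\dots\times I_d$. Let $[x_0;g]=g(x_0)$ and $[x_0,\dots,x_{n+1};g]=\frac{[x_1,\dots,x_{n+1};g]-[x_0,\dots,x_n;g]}{x_{n+1}-x_0}$ be the usual divided differences. A function $f\colon\mathbf I\to\mathbb R$ is called box-$(2,\dots,2)$-convex if, for all triples $\mathbf x_i=(x_{i0},x_{i1},x_{i2})$ of pairwise distinct points of $I_i$ ($i=1,\dots,d$), the multiple divided difference of $f$, obtained by applying the divided difference $[x_{i0},x_{i1},x_{i2};\cdot\,]$ in the $i$-th variable successively for $i=1,\dots,d$, is nonnegative (for $d=0$: the constant $f$ is nonnegative). Let $f\colon\mathbf I\to\mathbb R$ be continuous and box-$(2,\dots,2)$-convex. Given probability measures $\mu_i,\nu_i$ on $I_i$, for each $A\subset\{1,\dots,d\}$ let $Z_{1,A},\dots,Z_{d,A}$ be independent random variables such that $Z_{i,A}$ has law $\mu_i$ if $i\in A$ and law $\nu_i$ if $i\notin A$. Consider the inequality $$\sum_{A\subset\{1,\dots,d\}}(-1)^{|A|}\,\mathbb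 E f(Z_{1,A},\dots,Z_{d,A})\ge 0.\qquad(*)$$ 1. (Hermite–Hadamard inequalities.) Let $a_i,b_i\in I_i$, $a_i<b_i$, $i=1,\dots,d$. In each of the following two cases, all the expectations in $(*)$ exist and $(*)$ holds: (a) $\mu_i=\delta_{(a_i+b_i)/2}$ and $\nu_i$ is the uniform law on $[a_i,b_i]$ for all $i$; (b) $\mu_i$ is the uniform law on $[a_i,b_i]$ and $\nu_i=\frac12(\delta_{a_i}+\delta_{b_i})$ for all $i$. 2. (Case (a) for $d=3$.) If $d=3$, $a_i,b_i\in I_i$, $a_i<b_i$ and $c_i=\frac{a_i+b_i}2$, then $$\begin{aligned} &\tfrac1{(b_1-a_1)(b_2-a_2)(b_3-a_3)}\int_{a_1}^{b_1}\!\int_{a_2}^{b_2}\!\int_{a_3}^{b_3}f(x,y,z)\,dz\,dy\,dx -\tfrac1{(b_2-a_2)(b_3-a_3)}\int_{a_2}^{b_2}\!\int_{a_3}^{b_3}f(c_1,y,z)\,dz\,dy\\ &-\tfrac1{(b_1-a_1)(b_3-a_3)}\int_{a_1}^{b_1}\!\int_{a_3}^{b_3}f(x,c_2,z)\,dz\,dx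 -\tfrac1{(b_1-a_1)(b_2-a_2)}\int_{a_1}^{b_1}\!\int_{a_2}^{b_2}f(x,y,c_3)\,dy\,dx\\ &+\tfrac1{b_1-a_1}\int_{a_1}^{b_1}f(x,c_2,c_3)\,dx+\tfrac1{b_2-a_2}\int_{a_2}^{b_2}f(c_1,y,c_3)\,dy+\tfrac1{b_3-a_3}\int_{a_3}^{b_3}f(c_1,c_2,z)\,dz-f(c_1,c_2,c_3)\ge0. \end{aligned}$$ 3. (Jensen inequality.) Let $X_i$ be an $I_i$-valued random variable with $\mathbb E|X_i|<\infty$, $i=1,\dots,d$, let $\mu_i=\delta_{\mathbb E X_i}$ and let $\nu_i$ be the law of $X_i$. If all the expectations in $(*)$ exist (that is, each $f(Z_{1,A},\dots,Z_{d,A})$ is integrable), then $(*)$ holds. 4. (Jensen inequality for $d=3$.) Let $d=3$ and let $X,Y,Z$ be independent integrable random variables with values in $I_1,I_2,I_3$. If all the expectations below exist (the random variables are integrable), then $$\begin{aligned} &\mathbb E f(X,Y,Z)-\mathbb E f(\mathbb E X,Y,Z)-\mathbb E f(X,\mathbb E Y,Z)-\mathbb E f(X,Y,\mathbb E Z)\\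 &+\mathbb E f(X,\mathbb E Y,\mathbb E Z)+\mathbb E f(\mathbb E X,Y,\mathbb E Z)+\mathbb E f(\mathbb E X,\mathbb E Y,Z)-f(\mathbb E X,\mathbb E Y,\mathbb E Z)\ge0. \end{aligned}$$ 5. (Discrete Jensen inequality for $d=3$.) Let $d=3$, $M,N,L>1$, $x_1,\dots,x_M\in I_1$, $y_1,\dots,y_N\in I_2$, $z_1,\dots,z_L\in I_3$, let $\alpha_i,\beta_j,\gamma_k\ge0$ with $\sum_{i=1}^M\alpha_i=\sum_{j=1}^N\beta_j=\sum_{k=1}^L\gamma_k=1$, and put $\bar x=\sum_i\alpha_ix_i$, $\bar y=\sum_j\beta_jy_j$, $\bar z=\sum_k\gamma_kz_k$. Then $$\begin{aligned} &\sum_{i,j,k}\alpha_i\beta_j\gamma_kf(x_i,y_j,z_k)-\sum_{j,k}\beta_j\gamma_kf(\bar x,y_j,z_k)-\sum_{i,k}\alpha_i\gamma_kf(x_i,\bar y,z_k)-\sum_{i,j}\alpha_i\beta_jf(x_i,y_j,\bar z)\\ &+\sum_i\alpha_if(x_i,\bar y,\bar z)+\sum_j\beta_jf(\bar x,y_j,\bar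 z)+\sum_k\gamma_kf(\bar x,\bar y,z_k)-f(\bar x,\bar y,\bar z)\ge0. \end{aligned}$$ -/

import Mathlib

open MeasureTheory ProbabilityTheory

noncomputable section

/-- The divided difference `[x₀, x₁, …, xₙ; f]` of a function of one variable. -/
def dividedDiff : (n : ℕ) → (Fin (n + 1) → ℝ) → (ℝ → ℝ) → ℝ
  | 0, x, f => f (x 0)
  | n + 1, x, f =>
      (dividedDiff n (fun j => x j.succ) f - dividedDiff n (fun j => x j.castSucc) f) /
        (x (Fin.last (n + 1)) - x 0)

/-- The multiple divided difference of order `(n₁, …, n_d)` of a function of `d` variables: the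
one-dimensional divided difference in the last variable of the multiple divided difference in the
remaining variables. For `d = 0` it is the constant `f`. -/
def multiDividedDiff : (d : ℕ) → (n : Fin d → ℕ) → ((i : Fin d) → Fin (n i + 1) → ℝ) →
    ((Fin d → ℝ) → ℝ) → ℝ
  | 0, _, _, f => f ![]
  | d + 1, n, x, f =>
      dividedDiff (n (Fin.last d)) (x (Fin.last d)) fun t =>
        multiDividedDiff d (fun i => n i.castSucc) (fun i => x i.castSucc) fun y =>
          f (Fin.snoc y t)

/-- `f` is box-`n`-convex on the box `∏ I i`: all its multiple divided differences of order `n` with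
pairwise distinct nodes in each `I i` are nonnegative. Only the values of `f` on the box matter. -/
def BoxConvexOn {d : ℕ} (n : Fin d → ℕ) (I : Fin d → Set ℝ) (f : (Fin d → ℝ) → ℝ) : Prop :=
  ∀ x : (i : Fin d) → Fin (n i + 1) → ℝ,
    (∀ i j, x i j ∈ I i) → (∀ i, Function.Injective (x i)) → 0 ≤ multiDividedDiff d n x f

/-- The uniform law on `[a, b]` (for `a < b`). -/
def uniformLaw (a b : ℝ) : Measure ℝ :=
  ENNReal.ofReal (1 / (b - a)) • volume.restrict (Set.Icc a b)

/-- The law with mass `1 / 2` at each of `a` and `b`. -/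
def endpointLaw (a b : ℝ) : Measure ℝ :=
  (1 / 2 : ENNReal) • (Measure.dirac a + Measure.dirac b)

/-- `Z i`, `i : Fin d`, are independent random variables; `Z i` has law `μ i` if `i ∈ A` and law
`ν i` if `i ∉ A`. -/
structure IsMixedFamily {d : ℕ} (μ ν : Fin d → Measure ℝ) (A : Finset (Fin d))
    {Ω : Type*} [MeasurableSpace Ω] (P : Measure Ω) (Z : Fin d → Ω → ℝ) : Prop where
  indep : iIndepFun Z P
  law_mem : ∀ i ∈ A, HasLaw (Z i) (μ i) P
  law_not_mem : ∀ i ∉ A, HasLaw (Z i) (ν i) P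

/-- The alternating sum `∑_A (-1)^|A| E f(Z_{1,A}, …, Z_{d,A})` over all `A ⊆ {1, …, d}`. -/
def alternatingSum {d : ℕ} {Ω : Finset (Fin d) → Type*} [∀ A, MeasurableSpace (Ω A)]
    (P : ∀ A, Measure (Ω A)) (Z : ∀ A, Fin d → Ω A → ℝ) (f : (Fin d → ℝ) → ℝ) : ℝ :=
  ∑ A : Finset (Fin d), (-1) ^ A.card * ∫ ω, f (fun i => Z A i ω) ∂(P A)

end

noncomputable section

/-! The alternating sum is the integral of `f` against the product of the signed measures `ν i - μ
i`. In one variable each inequality `∫ φ ∂μ ≤ ∫ φ ∂ν` is an average of inequalities "second divided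
difference of `φ` is nonnegative" over a measure `τ` on triples of nodes (`TripleDomination`). For
Jensen the triple is `(p, m, q)`, with `m` the mean and `p < m < q` drawn independently from `ν`
(`tripleDomination_dirac`). For the trapezoidal bound it is `(a, t, b)` with `t` uniform
(`tripleDomination_uniformLaw`). The midpoint bound is Jensen for the uniform law.

The passage to `d` variables is an induction (`sum_mixedLaw_nonneg`). Put `g y = ∫ f (y, t) ∂ν - ∫ f
(y, t) ∂μ`, with `t` the last variable. Integration commutes with divided differences in `y`, so a
multiple divided difference of `g` equals `∫ φ ∂ν - ∫ φ ∂μ`, where `φ t` is the multiple divided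
difference of `f (·, t)`. The second divided differences of `φ` are those of `f`, so the
one-dimensional inequality makes this nonnegative, and `g` inherits the hypothesis.

By Fubini the integrals defining `g` converge only for almost every `y`. The induction therefore
runs with divided differences nonnegative at almost all nodes, and the marginals of `τ` must be
absolutely continuous with respect to `μ` or `ν`. Continuity of `f` serves only measurability and
integrability. -/

/-! ### Divided differences and their interchange with integrals. -/

theorem dividedDiff_congr {n : ℕ} {x : Fin (n + 1) → ℝ} {f g : ℝ → ℝ}
    (h : ∀ j, f (x j) = g (x j)) : dividedDiff n x f = dividedDiff n x g := by
  induction n with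
  | zero => exact h 0
  | succ n ih =>
    simp only [dividedDiff]
    rw [ih fun j => h j.succ, ih fun j => h j.castSucc]

theorem dividedDiff_sub {n : ℕ} (x : Fin (n + 1) → ℝ) (f g : ℝ → ℝ) :
    dividedDiff n x (fun t => f t - g t) = dividedDiff n x f - dividedDiff n x g := by
  induction n with
  | zero => rfl
  | succ n ih =>
    simp only [dividedDiff]
    rw [ih, ih]
    ring

theorem multiDividedDiff_sub {d : ℕ} (n : Fin d → ℕ) (x : (i : Fin d) → Fin (n i + 1) → ℝ)
    (f g : (Fin d → ℝ) → ℝ) :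
    multiDividedDiff d n x (fun y => f y - g y) =
      multiDividedDiff d n x f - multiDividedDiff d n x g := by
  induction d with
  | zero => rfl
  | succ d ih =>
    simp only [multiDividedDiff]
    rw [← dividedDiff_sub]
    simp only [ih]

theorem integral_dividedDiff {α : Type*} [MeasurableSpace α] {ρ : Measure α} {n : ℕ}
    (x : Fin (n + 1) → ℝ) (F : α → ℝ → ℝ) (h : ∀ j, Integrable (fun t => F t (x j)) ρ) :
    Integrable (fun t => dividedDiff n x (F t)) ρ ∧
      ∫ t, dividedDiff n x (F t) ∂ρ = dividedDiff n x fun u => ∫ t, F t u ∂ρ := by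
  induction n with
  | zero => exact ⟨h 0, rfl⟩
  | succ n ih =>
    obtain ⟨h₁, e₁⟩ := ih (fun j => x j.succ) fun j => h j.succ
    obtain ⟨h₂, e₂⟩ := ih (fun j => x j.castSucc) fun j => h j.castSucc
    simp only [dividedDiff]
    refine ⟨(h₁.sub h₂).div_const _, ?_⟩
    rw [integral_div, integral_sub h₁ h₂, e₁, e₂]

/-- A multiple divided difference is a finite linear combination of values on the grid of nodes.
Integrability is assumed on that grid only, because Fubini gives no more than integrability of
almost every section. -/
theorem integral_multiDividedDiff {α : Type*} [MeasurableSpace α] {ρ : Measure α} {d : ℕ}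
    (n : Fin d → ℕ) (x : (i : Fin d) → Fin (n i + 1) → ℝ) (F : α → (Fin d → ℝ) → ℝ)
    (h : ∀ s : (i : Fin d) → Fin (n i + 1), Integrable (fun t => F t fun i => x i (s i)) ρ) :
    Integrable (fun t => multiDividedDiff d n x (F t)) ρ ∧
      ∫ t, multiDividedDiff d n x (F t) ∂ρ = multiDividedDiff d n x fun y => ∫ t, F t y ∂ρ := by
  induction d with
  | zero =>
    have h0 := h finZeroElim
    have e : (fun i => x i ((finZeroElim : (i : Fin 0) → Fin (n i + 1)) i)) = ![] :=
      Subsingleton.elim _ _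
    rw [e] at h0
    exact ⟨h0, rfl⟩
  | succ d ih =>
    have key : ∀ j, Integrable (fun t => multiDividedDiff d (fun i => n i.castSucc)
          (fun i => x i.castSucc) fun y => F t (Fin.snoc y (x (Fin.last d) j))) ρ ∧
        ∫ t, (multiDividedDiff d (fun i => n i.castSucc)
          (fun i => x i.castSucc) fun y => F t (Fin.snoc y (x (Fin.last d) j))) ∂ρ =
        multiDividedDiff d (fun i => n i.castSucc)
          (fun i => x i.castSucc) fun y => ∫ t, F t (Fin.snoc y (x (Fin.last d) j)) ∂ρ := by
      intro j
      refine ih _ _ (fun t y => F t (Fin.snoc y (x (Fin.last d) j))) fun s => ?_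
      have e : (Fin.snoc (α := fun _ => ℝ) (fun i : Fin d => x i.castSucc (s i))
          (x (Fin.last d) j)) =
          fun i => x i (Fin.snoc (α := fun i => Fin (n i + 1)) s j i) := by
        funext i
        refine Fin.lastCases ?_ (fun i => ?_) i <;> simp
      simp only [e]
      exact h _
    obtain ⟨h₁, e₁⟩ := integral_dividedDiff (ρ := ρ) (x (Fin.last d))
      (fun t u => multiDividedDiff d (fun i => n i.castSucc)
          (fun i => x i.castSucc) fun y => F t (Fin.snoc y u)) fun j => (key j).1
    refine ⟨h₁, ?_⟩
    simp only [multiDividedDiff]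
    rw [e₁]
    -- The interchange is known only at the nodes in the last variable, and a divided difference
    -- sees nothing else.
    exact dividedDiff_congr fun j => (key j).2

/-! ### Finite product measures, with the last factor split off. -/

theorem measurePreserving_snoc {d : ℕ} {E : Type*} [MeasurableSpace E]
    (μ : Fin (d + 1) → Measure E) [∀ i, SigmaFinite (μ i)] :
    MeasurePreserving (fun p : (Fin d → E) × E => (Fin.snoc p.1 p.2 : Fin (d + 1) → E))
      ((Measure.pi fun i => μ i.castSucc).prod (μ (Fin.last d))) (Measure.pi μ) := by
  have h := (measurePreserving_piFinSuccAbove μ (Fin.last d)).symm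
  simp only [Fin.succAbove_last] at h
  have h2 := h.comp (Measure.measurePreserving_swap
    (μ := Measure.pi fun i : Fin d => μ i.castSucc) (ν := μ (Fin.last d)))
  convert h2 using 1
  funext p
  exact (Fin.insertNth_last' p.2 p.1).symm

theorem MeasureTheory.Measure.AbsolutelyContinuous.pi_fin {d : ℕ} {E : Type*} [MeasurableSpace E]
    {μ ν : Fin d → Measure E} [∀ i, SigmaFinite (μ i)] [∀ i, SigmaFinite (ν i)]
    (h : ∀ i, μ i ≪ ν i) : Measure.pi μ ≪ Measure.pi ν := by
  induction d with
  | zero => rw [Subsingleton.elim μ ν]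
  | succ d ih =>
    rw [← (measurePreserving_snoc μ).map_eq, ← (measurePreserving_snoc ν).map_eq]
    exact ((ih fun i => h i.castSucc).prod (h (Fin.last d))).map
      (measurePreserving_snoc μ).measurable

/-! ### Domination through triples, and the induction on the dimension. -/

/-- The law of the `i`-th coordinate is `μ i` for `i ∈ A` and `ν i` for `i ∉ A`. -/
def mixedLaw {d : ℕ} (μ ν : Fin d → Measure ℝ) (A : Finset (Fin d)) (i : Fin d) : Measure ℝ :=
  if i ∈ A then μ i else ν i

instance {d : ℕ} (μ ν : Fin d → Measure ℝ) [∀ i, IsProbabilityMeasure (μ i)]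
    [∀ i, IsProbabilityMeasure (ν i)] (A : Finset (Fin d)) (i : Fin d) :
    IsProbabilityMeasure (mixedLaw μ ν A i) := by
  unfold mixedLaw
  split_ifs <;> infer_instance

/-- The measure `τ` on triples certifies that `μ` is dominated by `ν` on functions with nonnegative
second divided differences. -/
structure TripleDomination (μ ν : Measure ℝ) (τ : Measure (Fin 3 → ℝ)) : Prop where
  -- The middle node is governed by `μ` and the outer nodes by `ν`; null sets of `μ` and `ν` are
  -- thus avoided by almost every triple.
  absolutelyContinuous : ∀ j, τ.map (fun x => x j) ≪ if j = 1 then μ else ν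
  integral_le : ∀ φ : ℝ → ℝ, Integrable φ μ → Integrable φ ν →
    (∀ᵐ x ∂τ, 0 ≤ dividedDiff 2 x φ) → ∫ t, φ t ∂μ ≤ ∫ t, φ t ∂ν

theorem sum_finset_fin_succ {d : ℕ} (F : Finset (Fin (d + 1)) → ℝ) :
    ∑ A, F A = ∑ B : Finset (Fin d),
      (F (B.map Fin.castSuccEmb) + F (insert (Fin.last d) (B.map Fin.castSuccEmb))) := by
  have h : (Finset.univ : Finset (Fin (d + 1))) =
      insert (Fin.last d) (Finset.univ.image Fin.castSuccEmb) := by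
    ext i
    refine Fin.lastCases ?_ (fun i => ?_) i <;> simp
  rw [← Finset.powerset_univ, h, Finset.sum_powerset_insert (by simp),
    Finset.powerset_image, Finset.sum_image, Finset.sum_image, Finset.powerset_univ,
    ← Finset.sum_add_distrib]
  · simp only [Finset.map_eq_image]
  all_goals exact fun A _ B _ e => Finset.image_injective Fin.castSuccEmb.injective e

theorem mixedLaw_map_castSucc {d : ℕ} (μ ν : Fin (d + 1) → Measure ℝ) (B : Finset (Fin d)) :
    (fun i : Fin d => mixedLaw μ ν (B.map Fin.castSuccEmb) i.castSucc) =
      mixedLaw (fun i => μ i.castSucc) (fun i => ν i.castSucc) B ∧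
    (fun i : Fin d => mixedLaw μ ν (insert (Fin.last d) (B.map Fin.castSuccEmb)) i.castSucc) =
      mixedLaw (fun i => μ i.castSucc) (fun i => ν i.castSucc) B ∧
    mixedLaw μ ν (B.map Fin.castSuccEmb) (Fin.last d) = ν (Fin.last d) ∧
    mixedLaw μ ν (insert (Fin.last d) (B.map Fin.castSuccEmb)) (Fin.last d) = μ (Fin.last d) := by
  refine ⟨?_, ?_, ?_, ?_⟩
  · funext i; simp [mixedLaw]
  · funext i; simp [mixedLaw, Fin.castSucc_ne_last]
  · simp [mixedLaw, Fin.castSucc_ne_last]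
  · simp [mixedLaw]

/-- Transfers almost-everywhere statements about points `y` to all grid points of a random family of
triples: selecting the node `s i` in coordinate `i` gives a point whose null sets are controlled by
the mixed law with `A` the set of coordinates where the middle node is chosen. -/
theorem TripleDomination.quasiMeasurePreserving {d : ℕ} {μ ν : Fin d → Measure ℝ}
    [∀ i, IsProbabilityMeasure (μ i)] [∀ i, IsProbabilityMeasure (ν i)]
    {τ : Fin d → Measure (Fin 3 → ℝ)} [∀ i, IsFiniteMeasure (τ i)]
    (h : ∀ i, TripleDomination (μ i) (ν i) (τ i)) (s : Fin d → Fin 3) :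
    Measure.QuasiMeasurePreserving (fun (x : Fin d → Fin 3 → ℝ) i => x i (s i)) (Measure.pi τ)
      (Measure.pi (mixedLaw μ ν (Finset.univ.filter fun i => s i = 1))) := by
  refine ⟨by fun_prop, ?_⟩
  rw [Measure.pi_map_pi (μ := τ) (f := fun i (x : Fin 3 → ℝ) => x (s i)) (fun i => (measurable_pi_apply (s i)).aemeasurable)]
  refine Measure.AbsolutelyContinuous.pi_fin fun i => ?_
  simpa [mixedLaw] using (h i).absolutelyContinuous (s i)

/-- The alternating sum is nonnegative as soon as the divided differences of `f` are nonnegative at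
almost all families of triples. The proof integrates out the last variable. -/
theorem sum_mixedLaw_nonneg {d : ℕ} {μ ν : Fin d → Measure ℝ}
    [∀ i, IsProbabilityMeasure (μ i)] [∀ i, IsProbabilityMeasure (ν i)]
    {τ : Fin d → Measure (Fin 3 → ℝ)} [∀ i, IsFiniteMeasure (τ i)]
    (h : ∀ i, TripleDomination (μ i) (ν i) (τ i)) {f : (Fin d → ℝ) → ℝ}
    (hint : ∀ A, Integrable f (Measure.pi (mixedLaw μ ν A)))
    (hf : ∀ᵐ x ∂Measure.pi τ, 0 ≤ multiDividedDiff d (fun _ => 2) x f) :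
    0 ≤ ∑ A : Finset (Fin d), (-1) ^ A.card * ∫ y, f y ∂Measure.pi (mixedLaw μ ν A) := by
  induction d with
  | zero =>
    rw [Measure.pi_of_empty τ finZeroElim, ae_dirac_eq] at hf
    have hf : 0 ≤ f ![] := hf
    simp only [Finset.univ_unique, Finset.sum_singleton]
    rw [Measure.pi_of_empty _ ![]]
    simpa [Finset.eq_empty_of_isEmpty] using hf
  | succ d ih =>
    set μ' : Fin d → Measure ℝ := fun i => μ i.castSucc with hμ'
    set ν' : Fin d → Measure ℝ := fun i => ν i.castSucc with hν'
    set τ' : Fin d → Measure (Fin 3 → ℝ) := fun i => τ i.castSucc with hτ'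
    set m := μ (Fin.last d)
    set n := ν (Fin.last d)
    have mp₀ : ∀ B : Finset (Fin d), MeasurePreserving
        (fun p : (Fin d → ℝ) × ℝ => (Fin.snoc p.1 p.2 : Fin (d + 1) → ℝ))
        ((Measure.pi (mixedLaw μ' ν' B)).prod n)
        (Measure.pi (mixedLaw μ ν (B.map Fin.castSuccEmb))) := by
      intro B
      obtain ⟨e₁, -, e₂, -⟩ := mixedLaw_map_castSucc μ ν B
      have := measurePreserving_snoc (mixedLaw μ ν (B.map Fin.castSuccEmb))
      rwa [e₁, e₂] at this
    have mp₁ : ∀ B : Finset (Fin d), MeasurePreserving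
        (fun p : (Fin d → ℝ) × ℝ => (Fin.snoc p.1 p.2 : Fin (d + 1) → ℝ))
        ((Measure.pi (mixedLaw μ' ν' B)).prod m)
        (Measure.pi (mixedLaw μ ν (insert (Fin.last d) (B.map Fin.castSuccEmb)))) := by
      intro B
      obtain ⟨-, e₁, -, e₂⟩ := mixedLaw_map_castSucc μ ν B
      have := measurePreserving_snoc (mixedLaw μ ν (insert (Fin.last d) (B.map Fin.castSuccEmb)))
      rwa [e₁, e₂] at this
    have int₀ : ∀ B : Finset (Fin d), Integrable
        (fun p : (Fin d → ℝ) × ℝ => f (Fin.snoc p.1 p.2))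
        ((Measure.pi (mixedLaw μ' ν' B)).prod n) := fun B =>
      (mp₀ B).integrable_comp_of_integrable (hint _)
    have int₁ : ∀ B : Finset (Fin d), Integrable
        (fun p : (Fin d → ℝ) × ℝ => f (Fin.snoc p.1 p.2))
        ((Measure.pi (mixedLaw μ' ν' B)).prod m) := fun B =>
      (mp₁ B).integrable_comp_of_integrable (hint _)
    have eq₀ : ∀ B : Finset (Fin d),
        ∫ y, f y ∂Measure.pi (mixedLaw μ ν (B.map Fin.castSuccEmb)) =
        ∫ y, ∫ t, f (Fin.snoc y t) ∂n ∂Measure.pi (mixedLaw μ' ν' B) := by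
      intro B
      have hm := (hint (B.map Fin.castSuccEmb)).aestronglyMeasurable
      rw [← (mp₀ B).map_eq] at hm ⊢
      rw [integral_map (mp₀ B).aemeasurable hm]
      exact integral_prod _ (int₀ B)
    have eq₁ : ∀ B : Finset (Fin d),
        ∫ y, f y ∂Measure.pi (mixedLaw μ ν (insert (Fin.last d) (B.map Fin.castSuccEmb))) =
        ∫ y, ∫ t, f (Fin.snoc y t) ∂m ∂Measure.pi (mixedLaw μ' ν' B) := by
      intro B
      have hm := (hint (insert (Fin.last d) (B.map Fin.castSuccEmb))).aestronglyMeasurable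
      rw [← (mp₁ B).map_eq] at hm ⊢
      rw [integral_map (mp₁ B).aemeasurable hm]
      exact integral_prod _ (int₁ B)
    have hfst : ∀ᵐ x ∂Measure.pi τ',
        0 ≤ multiDividedDiff d (fun _ => 2) x
          fun y => ∫ t, f (Fin.snoc y t) ∂n - ∫ t, f (Fin.snoc y t) ∂m := by
      -- For almost every family of triples in the first `d` variables, the hypothesis holds for
      -- almost every last triple, and all `3 ^ d` grid sections are integrable for both last laws.
      have h₁ := Measure.ae_ae_of_ae_prod ((measurePreserving_snoc τ).quasiMeasurePreserving.ae hf)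
      have h₂ : ∀ᵐ x ∂Measure.pi τ', ∀ s : Fin d → Fin 3,
          Integrable (fun t => f (Fin.snoc (fun i => x i (s i)) t)) n := ae_all_iff.2 fun s =>
        (TripleDomination.quasiMeasurePreserving (fun i => h i.castSucc) s).ae (int₀ _).prod_right_ae
      have h₃ : ∀ᵐ x ∂Measure.pi τ', ∀ s : Fin d → Fin 3,
          Integrable (fun t => f (Fin.snoc (fun i => x i (s i)) t)) m := ae_all_iff.2 fun s =>
        (TripleDomination.quasiMeasurePreserving (fun i => h i.castSucc) s).ae (int₁ _).prod_right_ae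
      filter_upwards [h₁, h₂, h₃] with x h₁ h₂ h₃
      obtain ⟨i₂, e₂⟩ := integral_multiDividedDiff (fun _ => 2) x
        (fun t y => f (Fin.snoc y t)) h₂
      obtain ⟨i₃, e₃⟩ := integral_multiDividedDiff (fun _ => 2) x
        (fun t y => f (Fin.snoc y t)) h₃
      -- What remains is the one-dimensional domination for `φ t`, the multiple divided difference
      -- of `f (·, t)`.
      rw [multiDividedDiff_sub, ← e₂, ← e₃, sub_nonneg]
      refine (h (Fin.last d)).integral_le _ i₃ i₂ ?_
      filter_upwards [h₁] with z hz
      simpa [multiDividedDiff] using hz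
    have := ih (fun i => h i.castSucc)
      (fun B => (int₀ B).integral_prod_left.sub (int₁ B).integral_prod_left) hfst
    refine this.trans_eq ?_
    -- The sets `B` and `B ∪ {last}` carry opposite signs, so each pair contributes the integral of
    -- the difference `∫ ∂n - ∫ ∂m`.
    rw [sum_finset_fin_succ]
    refine Finset.sum_congr rfl fun B _ => ?_
    rw [eq₀, eq₁, Finset.card_insert_of_notMem (by simp [Fin.castSucc_ne_last]), Finset.card_map,
      pow_succ, integral_sub' (int₀ B).integral_prod_left (int₁ B).integral_prod_left]
    ring

/-! ### The one-dimensional Jensen domination. -/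

/-- Cleared denominators in the second divided difference. -/
theorem dividedDiff_two_mul {x y z : ℝ} (hxy : x < y) (hyz : y < z) (φ : ℝ → ℝ) :
    (z - x) * (y - x) * (z - y) * dividedDiff 2 ![x, y, z] φ =
      (z - y) * (φ x - φ y) + (y - x) * (φ z - φ y) := by
  have h₁ : y - x ≠ 0 := (sub_pos.2 hxy).ne'
  have h₂ : z - y ≠ 0 := (sub_pos.2 hyz).ne'
  have h₃ : z - x ≠ 0 := (sub_pos.2 (hxy.trans hyz)).ne'
  have e : dividedDiff 2 ![x, y, z] φ =
      ((φ z - φ y) / (z - y) - (φ y - φ x) / (y - x)) / (z - x) := by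
    simp [dividedDiff, Fin.last]
  rw [e]
  field_simp
  ring

/-- For fixed `y` each term is a function of `x` times a function of `z`, so integrals over
independent pairs factor. -/
theorem dividedDiff_two_nonneg {x y z : ℝ} (hxy : x < y) (hyz : y < z) {φ : ℝ → ℝ}
    (h : 0 ≤ dividedDiff 2 ![x, y, z] φ) :
    0 ≤ (z - y) * (φ x - φ y) + (y - x) * (φ z - φ y) := by
  rw [← dividedDiff_two_mul hxy hyz]
  have h₁ : 0 < y - x := sub_pos.2 hxy
  have h₂ : 0 < z - y := sub_pos.2 hyz
  have h₃ : 0 < z - x := sub_pos.2 (hxy.trans hyz)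
  positivity

/-- Pairs of independent points with law `ν` lying on the two sides of `m`, together with `m`. -/
def straddleLaw (ν : Measure ℝ) (m : ℝ) : Measure (Fin 3 → ℝ) :=
  ((ν.prod ν).restrict {p | p.1 < m ∧ m < p.2}).map fun p => ![p.1, m, p.2]

theorem measurable_straddle (m : ℝ) : Measurable fun p : ℝ × ℝ => ![p.1, m, p.2] := by
  refine measurable_pi_iff.2 fun j => ?_
  fin_cases j <;> simp <;> fun_prop

theorem measurableSet_straddle (m : ℝ) : MeasurableSet {p : ℝ × ℝ | p.1 < m ∧ m < p.2} :=
  (measurableSet_lt measurable_fst measurable_const).inter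
    (measurableSet_lt measurable_const measurable_snd)

instance (ν : Measure ℝ) [IsFiniteMeasure ν] (m : ℝ) : IsFiniteMeasure (straddleLaw ν m) := by
  unfold straddleLaw; infer_instance

theorem tripleDomination_dirac {ν : Measure ℝ} [IsProbabilityMeasure ν] {m : ℝ}
    (hν : Integrable (fun t => t) ν) (hm : ∫ t, t ∂ν = m) :
    TripleDomination (Measure.dirac m) ν (straddleLaw ν m) where
  absolutelyContinuous j := by
    rw [straddleLaw, Measure.map_map (measurable_pi_apply j) (measurable_straddle m)]
    fin_cases j
    · exact (Measure.absolutelyContinuous_of_le Measure.restrict_le_self).map measurable_fst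
        |>.trans Measure.quasiMeasurePreserving_fst.absolutelyContinuous
    · change Measure.map (fun _ => m) _ ≪ Measure.dirac m
      rw [Measure.map_const]
      exact Measure.smul_absolutelyContinuous
    · exact (Measure.absolutelyContinuous_of_le Measure.restrict_le_self).map measurable_snd
        |>.trans Measure.quasiMeasurePreserving_snd.absolutelyContinuous
  integral_le φ _ hφ h := by
    rw [integral_dirac]
    have h := ae_of_ae_map (measurable_straddle m).aemeasurable h
    rw [ae_restrict_iff' (measurableSet_straddle m)] at h
    set u : ℝ → ℝ := (Set.Iio m).indicator fun _ => 1 with hu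
    set v : ℝ → ℝ := (Set.Ioi m).indicator fun _ => 1 with hv
    have uint : ∀ g : ℝ → ℝ, Integrable g ν → Integrable (fun t => u t * g t) ν := by
      intro g hg
      refine (hg.indicator (measurableSet_Iio (a := m))).congr
        (Filter.Eventually.of_forall fun t => ?_)
      by_cases ht : t < m <;> simp [hu, Set.indicator, ht]
    have vint : ∀ g : ℝ → ℝ, Integrable g ν → Integrable (fun t => v t * g t) ν := by
      intro g hg
      refine (hg.indicator (measurableSet_Ioi (a := m))).congr
        (Filter.Eventually.of_forall fun t => ?_)
      by_cases ht : m < t <;> simp [hv, Set.indicator, ht]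
    have hψ : Integrable (fun t => φ t - φ m) ν := hφ.sub (integrable_const _)
    have hi : Integrable (fun t => t - m) ν := hν.sub (integrable_const _)
    have hi' : Integrable (fun t => m - t) ν := (integrable_const _).sub hν
    -- At `t = m` both indicators vanish; this is harmless because they are multiplied by `t - m` or
    -- `φ t - φ m`.
    have split : ∀ t, t ≠ m → u t + v t = 1 := by
      intro t ht
      rcases lt_or_gt_of_ne ht with ht | ht <;> simp [hu, hv, ht, ht.not_gt]
    -- Since `m` is the mean, the first moments about `m` on the two sides balance. Their common
    -- value `C` becomes the factor in `C * (∫ φ ∂ν - φ m) ≥ 0`.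
    have hc : ∫ t, u t * (m - t) ∂ν = ∫ t, v t * (t - m) ∂ν := by
      have h0 : ∫ t, (v t * (t - m) - u t * (m - t)) ∂ν = 0 := by
        have : ∀ t, v t * (t - m) - u t * (m - t) = t - m := by
          intro t
          by_cases ht : t = m
          · simp [ht]
          · linear_combination (t - m) * split t ht
        simp only [this]
        rw [integral_sub hν (integrable_const _), hm]
        simp
      rw [integral_sub (vint _ hi) (uint _ hi')] at h0
      linarith
    have hsum : ∫ t, u t * (φ t - φ m) ∂ν + ∫ t, v t * (φ t - φ m) ∂ν = ∫ t, φ t ∂ν - φ m := by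
      rw [← integral_add (uint _ hψ) (vint _ hψ)]
      have : ∀ t, u t * (φ t - φ m) + v t * (φ t - φ m) = φ t - φ m := by
        intro t
        by_cases ht : t = m
        · simp [ht]
        · linear_combination (φ t - φ m) * split t ht
      simp only [this]
      rw [integral_sub hφ (integrable_const _)]
      simp
    have u0 : ∀ t, 0 ≤ u t := fun t => Set.indicator_nonneg (fun _ _ => zero_le_one) t
    have v0 : ∀ t, 0 ≤ v t := fun t => Set.indicator_nonneg (fun _ _ => zero_le_one) t
    have um : ∀ t, 0 ≤ u t * (m - t) := by
      intro t
      by_cases ht : t < m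
      · exact mul_nonneg (u0 t) (by linarith)
      · simp [hu, ht]
    have vm : ∀ t, 0 ≤ v t * (t - m) := by
      intro t
      by_cases ht : m < t
      · exact mul_nonneg (v0 t) (by linarith)
      · simp [hv, ht]
    have key : 0 ≤ ∫ p : ℝ × ℝ, (u p.1 * (φ p.1 - φ m)) * (v p.2 * (p.2 - m)) +
        (u p.1 * (m - p.1)) * (v p.2 * (φ p.2 - φ m)) ∂(ν.prod ν) := by
      refine integral_nonneg_of_ae ?_
      filter_upwards [h] with p hp
      by_cases hpm : p.1 < m ∧ m < p.2
      · have := dividedDiff_two_nonneg hpm.1 hpm.2 (hp hpm)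
        simp only [hu, hv, Set.indicator, Set.mem_Iio, Set.mem_Ioi, hpm, if_true, Pi.zero_apply]
        linarith
      · have : u p.1 = 0 ∨ v p.2 = 0 := by
          rcases not_and_or.1 hpm with h0 | h0
          · exact Or.inl (by simp [hu, not_lt.1 h0])
          · exact Or.inr (by simp [hv, not_lt.1 h0])
        rcases this with h0 | h0 <;> simp [h0]
    rw [integral_add ((uint _ hψ).mul_prod (vint _ hi)) ((uint _ hi').mul_prod (vint _ hψ)),
      integral_prod_mul (fun t => u t * (φ t - φ m)) (fun t => v t * (t - m)),
      integral_prod_mul (fun t => u t * (m - t)) (fun t => v t * (φ t - φ m)), hc, mul_comm,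
      ← mul_add, hsum] at key
    -- If `C = 0`, then `ν` is concentrated at `m` and equality holds; otherwise divide by `C`.
    rcases (integral_nonneg vm : 0 ≤ ∫ t, v t * (t - m) ∂ν).eq_or_lt with h0 | h0
    · have hv0 := (integral_eq_zero_iff_of_nonneg vm (vint _ hi)).1 h0.symm
      have hu0 := (integral_eq_zero_iff_of_nonneg um (uint _ hi')).1 (hc.trans h0.symm)
      have : φ =ᵐ[ν] fun _ => φ m := by
        filter_upwards [hv0, hu0] with t h₁ h₂
        have : t = m := by
          by_contra ht
          have h₁ : v t * (t - m) = 0 := h₁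
          have h₂ : u t * (m - t) = 0 := h₂
          exact ht (by linear_combination h₁ - h₂ - (t - m) * split t ht)
        rw [this]
      rw [integral_congr_ae this]
      simp
    · exact sub_nonneg.1 (nonneg_of_mul_nonneg_right key h0)

/-! ### Uniform and endpoint laws, and the trapezoidal domination. -/

theorem uniformLaw_integral {a b : ℝ} (hab : a < b) (φ : ℝ → ℝ) :
    ∫ t, φ t ∂uniformLaw a b = 1 / (b - a) * ∫ t in a..b, φ t := by
  have h : 0 ≤ 1 / (b - a) := by have := sub_pos.2 hab; positivity
  rw [uniformLaw, integral_smul_measure, ENNReal.toReal_ofReal h, smul_eq_mul,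
    intervalIntegral.integral_of_le hab.le, integral_Icc_eq_integral_Ioc]

theorem isProbabilityMeasure_uniformLaw {a b : ℝ} (hab : a < b) :
    IsProbabilityMeasure (uniformLaw a b) := by
  refine ⟨?_⟩
  have h : 0 < b - a := sub_pos.2 hab
  rw [uniformLaw, Measure.smul_apply, Measure.restrict_apply_univ, Real.volume_Icc, smul_eq_mul,
    ← ENNReal.ofReal_mul (by positivity), one_div_mul_cancel h.ne', ENNReal.ofReal_one]

theorem ae_mem_Icc_uniformLaw (a b : ℝ) : ∀ᵐ t ∂uniformLaw a b, t ∈ Set.Icc a b :=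
  Measure.smul_absolutelyContinuous.ae_le (ae_restrict_mem measurableSet_Icc)

theorem integral_id_uniformLaw {a b : ℝ} (hab : a < b) :
    ∫ t, t ∂uniformLaw a b = (a + b) / 2 := by
  have h : b - a ≠ 0 := (sub_pos.2 hab).ne'
  rw [uniformLaw_integral hab (fun t => t), integral_id]
  field_simp
  ring

theorem integrable_id_uniformLaw (a b : ℝ) : Integrable (fun t => t) (uniformLaw a b) := by
  have h : Integrable (fun t : ℝ => t) (volume.restrict (Set.Icc a b)) :=
    continuous_id.integrableOn_Icc
  exact h.smul_measure ENNReal.ofReal_ne_top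

instance (a b : ℝ) : IsProbabilityMeasure (endpointLaw a b) := by
  refine ⟨?_⟩
  simp [endpointLaw, ENNReal.inv_two_add_inv_two]

theorem endpointLaw_integral (a b : ℝ) (φ : ℝ → ℝ) :
    ∫ t, φ t ∂endpointLaw a b = (φ a + φ b) / 2 := by
  rw [endpointLaw, integral_smul_measure, integral_add_measure
    (integrable_dirac enorm_lt_top) (integrable_dirac enorm_lt_top), integral_dirac, integral_dirac]
  simp
  ring

/-- The triples `(a, t, b)` with `t` uniform on `[a, b]`. -/
def chordLaw (a b : ℝ) : Measure (Fin 3 → ℝ) := (uniformLaw a b).map fun t => ![a, t, b]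

theorem measurable_chord (a b : ℝ) : Measurable fun t : ℝ => ![a, t, b] := by
  refine measurable_pi_iff.2 fun j => ?_
  fin_cases j <;> simp; fun_prop

/-- The open interval is needed so that `a`, `t`, `b` are pairwise distinct nodes. -/
theorem ae_mem_Ioo_uniformLaw (a b : ℝ) : ∀ᵐ t ∂uniformLaw a b, t ∈ Set.Ioo a b := by
  refine Measure.smul_absolutelyContinuous.ae_le ?_
  rw [← Measure.restrict_congr_set (Ioo_ae_eq_Icc (μ := volume))]
  exact ae_restrict_mem measurableSet_Ioo

theorem tripleDomination_uniformLaw {a b : ℝ} (hab : a < b) :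
    TripleDomination (uniformLaw a b) (endpointLaw a b) (chordLaw a b) where
  absolutelyContinuous j := by
    have := isProbabilityMeasure_uniformLaw hab
    have ha : Measure.dirac a ≪ endpointLaw a b :=
      (Measure.absolutelyContinuous_of_le (Measure.le_add_right le_rfl)).trans
        (Measure.absolutelyContinuous_smul (by simp))
    have hb : Measure.dirac b ≪ endpointLaw a b :=
      (Measure.absolutelyContinuous_of_le (Measure.le_add_left le_rfl)).trans
        (Measure.absolutelyContinuous_smul (by simp))
    rw [chordLaw, Measure.map_map (measurable_pi_apply j) (measurable_chord a b)]
    fin_cases j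
    · change Measure.map (fun _ => a) _ ≪ endpointLaw a b
      simpa [Measure.map_const] using ha
    · change Measure.map id _ ≪ uniformLaw a b
      rw [Measure.map_id]
    · change Measure.map (fun _ => b) _ ≪ endpointLaw a b
      simpa [Measure.map_const] using hb
  integral_le φ hφ _ h := by
    have := isProbabilityMeasure_uniformLaw hab
    have h := ae_of_ae_map (measurable_chord a b).aemeasurable h
    have hid := integrable_id_uniformLaw a b
    have hba : 0 < b - a := sub_pos.2 hab
    -- The graph lies below its chord. Since the mean is `(a + b) / 2`, both weights `b - t` and `t
    -- - a` integrate to `(b - a) / 2`.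
    have key : 0 ≤ ∫ t, ((b - t) * φ a + (t - a) * φ b - (b - a) * φ t) ∂uniformLaw a b := by
      refine integral_nonneg_of_ae ?_
      filter_upwards [h, ae_mem_Ioo_uniformLaw a b] with t ht htm
      have := dividedDiff_two_nonneg htm.1 htm.2 ht
      simp only [Pi.zero_apply]
      linarith
    have i₁ : Integrable (fun t => b - t) (uniformLaw a b) := (integrable_const _).sub hid
    have i₂ : Integrable (fun t => t - a) (uniformLaw a b) := hid.sub (integrable_const _)
    have i₃ : Integrable (fun t => (b - t) * φ a + (t - a) * φ b) (uniformLaw a b) :=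
      (i₁.mul_const _).add (i₂.mul_const _)
    rw [integral_sub i₃ (hφ.const_mul _), integral_add (i₁.mul_const _) (i₂.mul_const _), integral_mul_const, integral_mul_const,
      integral_const_mul, integral_sub (integrable_const _) hid, integral_sub hid
      (integrable_const _), integral_id_uniformLaw hab] at key
    simp only [integral_const, probReal_univ, one_smul] at key
    rw [endpointLaw_integral]
    refine le_of_mul_le_mul_left ?_ hba
    linarith

/-! ### Supports, measurability and integrability on the box. -/

theorem ae_pi_mem {d : ℕ} {E : Type*} [MeasurableSpace E] {ρ : Fin d → Measure E}
    [∀ i, SigmaFinite (ρ i)] {S : Fin d → Set E} (h : ∀ i, ∀ᵐ t ∂ρ i, t ∈ S i) :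
    ∀ᵐ y ∂Measure.pi ρ, y ∈ Set.univ.pi S := by
  have : ∀ᵐ y ∂Measure.pi ρ, ∀ i, y i ∈ S i :=
    Filter.eventually_all.2 fun i => Measure.tendsto_eval_ae_ae.eventually (h i)
  filter_upwards [this] with y hy i _ using hy i

/-- Off the box `f` is arbitrary, but the box is measurable and carries the whole mass. -/
theorem aestronglyMeasurable_pi_of_continuousOn {d : ℕ} {I : Fin d → Set ℝ}
    (hI : ∀ i, (I i).OrdConnected) {f : (Fin d → ℝ) → ℝ} (hf : ContinuousOn f (Set.univ.pi I))
    {ρ : Fin d → Measure ℝ} [∀ i, SigmaFinite (ρ i)] (hρ : ∀ i, ∀ᵐ t ∂ρ i, t ∈ I i) :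
    AEStronglyMeasurable f (Measure.pi ρ) := by
  rw [← Measure.restrict_eq_self_of_ae_mem (ae_pi_mem hρ)]
  exact hf.aestronglyMeasurable (MeasurableSet.univ_pi fun i => (hI i).measurableSet)

theorem integrable_pi_of_isCompact {d : ℕ} {I K : Fin d → Set ℝ} (hK : ∀ i, IsCompact (K i))
    (hKI : ∀ i, K i ⊆ I i) {f : (Fin d → ℝ) → ℝ} (hf : ContinuousOn f (Set.univ.pi I))
    {ρ : Fin d → Measure ℝ} [∀ i, IsFiniteMeasure (ρ i)] (hρ : ∀ i, ∀ᵐ t ∂ρ i, t ∈ K i) :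
    Integrable f (Measure.pi ρ) := by
  rw [← Measure.restrict_eq_self_of_ae_mem (ae_pi_mem hρ)]
  exact (hf.mono (Set.pi_mono fun i _ => hKI i)).integrableOn_compact (isCompact_univ_pi hK)

theorem ae_dirac_mem {m : ℝ} {S : Set ℝ} (hm : m ∈ S) : ∀ᵐ t ∂Measure.dirac m, t ∈ S := by
  rw [ae_dirac_eq]
  exact hm

theorem ae_mixedLaw {d : ℕ} {μ ν : Fin d → Measure ℝ} {S : Fin d → Set ℝ}
    (hμ : ∀ i, ∀ᵐ t ∂μ i, t ∈ S i) (hν : ∀ i, ∀ᵐ t ∂ν i, t ∈ S i) (A : Finset (Fin d))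
    (i : Fin d) : ∀ᵐ t ∂mixedLaw μ ν A i, t ∈ S i := by
  unfold mixedLaw
  split_ifs
  exacts [hμ i, hν i]

theorem BoxConvexOn.sum_mixedLaw_nonneg {d : ℕ} {I : Fin d → Set ℝ} {f : (Fin d → ℝ) → ℝ}
    (hf : BoxConvexOn (fun _ => 2) I f) {μ ν : Fin d → Measure ℝ}
    [∀ i, IsProbabilityMeasure (μ i)] [∀ i, IsProbabilityMeasure (ν i)]
    {τ : Fin d → Measure (Fin 3 → ℝ)} [∀ i, IsFiniteMeasure (τ i)]
    (h : ∀ i, TripleDomination (μ i) (ν i) (τ i))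
    (hτ : ∀ i, ∀ᵐ x ∂τ i, x ∈ {x : Fin 3 → ℝ | (∀ j, x j ∈ I i) ∧ Function.Injective x})
    (hint : ∀ A, Integrable f (Measure.pi (mixedLaw μ ν A))) :
    0 ≤ ∑ A : Finset (Fin d), (-1) ^ A.card * ∫ y, f y ∂Measure.pi (mixedLaw μ ν A) := by
  refine _root_.sum_mixedLaw_nonneg h hint ?_
  filter_upwards [ae_pi_mem hτ] with x hx
  exact hf x (fun i => (hx i trivial).1) fun i => (hx i trivial).2

theorem injective_triple {x y z : ℝ} (hxy : x < y) (hyz : y < z) :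
    Function.Injective ![x, y, z] := by
  have : StrictMono ![x, y, z] := by
    rw [Fin.strictMono_iff_lt_succ]
    intro i
    fin_cases i
    exacts [hxy, hyz]
  exact this.injective

theorem forall_triple_mem {x y z : ℝ} {S : Set ℝ} (hx : x ∈ S) (hy : y ∈ S) (hz : z ∈ S) (j : Fin 3) :
    ![x, y, z] j ∈ S := by
  fin_cases j
  exacts [hx, hy, hz]

theorem measurableSet_injective_triple {S : Set ℝ} (hS : MeasurableSet S) :
    MeasurableSet {x : Fin 3 → ℝ | (∀ j, x j ∈ S) ∧ Function.Injective x} := by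
  have : {x : Fin 3 → ℝ | (∀ j, x j ∈ S) ∧ Function.Injective x} =
      (⋂ j, {x | x j ∈ S}) ∩ ⋂ i, ⋂ j, {x : Fin 3 → ℝ | x i = x j → i = j} := by
    ext x; simp [Function.Injective]
  rw [this]
  refine (MeasurableSet.iInter fun j => measurable_pi_apply j hS).inter
    (MeasurableSet.iInter fun i => MeasurableSet.iInter fun j => ?_)
  by_cases hij : i = j
  · simp [hij]
  · simp only [hij, imp_false]
    exact (measurableSet_eq_fun (measurable_pi_apply i) (measurable_pi_apply j)).compl

theorem ae_straddleLaw {ν : Measure ℝ} [IsProbabilityMeasure ν] {m : ℝ} {S : Set ℝ}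
    (hS : MeasurableSet S) (hν : ∀ᵐ t ∂ν, t ∈ S) (hm : m ∈ S) :
    ∀ᵐ x ∂straddleLaw ν m, x ∈ {x : Fin 3 → ℝ | (∀ j, x j ∈ S) ∧ Function.Injective x} := by
  refine (ae_map_iff (measurable_straddle m).aemeasurable
    (measurableSet_injective_triple hS)).2 ?_
  rw [ae_restrict_iff' (measurableSet_straddle m)]
  filter_upwards [Measure.quasiMeasurePreserving_fst.ae hν,
    Measure.quasiMeasurePreserving_snd.ae hν] with p h₁ h₂ hp
  exact ⟨forall_triple_mem h₁ hm h₂, injective_triple hp.1 hp.2⟩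

theorem ae_chordLaw {a b : ℝ} {S : Set ℝ} (hS : S.OrdConnected) (ha : a ∈ S) (hb : b ∈ S) :
    ∀ᵐ x ∂chordLaw a b, x ∈ {x : Fin 3 → ℝ | (∀ j, x j ∈ S) ∧ Function.Injective x} := by
  refine (ae_map_iff (measurable_chord a b).aemeasurable
    (measurableSet_injective_triple hS.measurableSet)).2 ?_
  filter_upwards [ae_mem_Ioo_uniformLaw a b] with t ht
  exact ⟨forall_triple_mem ha (hS.out ha hb ⟨ht.1.le, ht.2.le⟩) hb, injective_triple ht.1 ht.2⟩

/-- Some point of `S` is at most the mean and some point is at least the mean, so no closedness of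
`S` is needed. -/
theorem mean_mem {ν : Measure ℝ} [IsProbabilityMeasure ν] {S : Set ℝ} (hS : S.OrdConnected)
    (hν : ∀ᵐ t ∂ν, t ∈ S) (hid : Integrable (fun t => t) ν) : ∫ t, t ∂ν ∈ S := by
  obtain ⟨x, hx, hx'⟩ := exists_notMem_null_le_integral hid (ae_iff.1 hν)
  obtain ⟨y, hy, hy'⟩ := exists_notMem_null_integral_le hid (ae_iff.1 hν)
  exact hS.out (not_not.1 hx) (not_not.1 hy) ⟨hx', hy'⟩

/-- The Jensen inequality in terms of laws. -/
theorem BoxConvexOn.jensen {d : ℕ} {I : Fin d → Set ℝ} {f : (Fin d → ℝ) → ℝ}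
    (hf : BoxConvexOn (fun _ => 2) I f) (hI : ∀ i, (I i).OrdConnected)
    {ν : Fin d → Measure ℝ} [∀ i, IsProbabilityMeasure (ν i)] {m : Fin d → ℝ}
    (hν : ∀ i, ∀ᵐ t ∂ν i, t ∈ I i) (hid : ∀ i, Integrable (fun t => t) (ν i))
    (hm : ∀ i, ∫ t, t ∂ν i = m i)
    (hint : ∀ A, Integrable f (Measure.pi (mixedLaw (fun i => Measure.dirac (m i)) ν A))) :
    0 ≤ ∑ A : Finset (Fin d),
      (-1) ^ A.card * ∫ y, f y ∂Measure.pi (mixedLaw (fun i => Measure.dirac (m i)) ν A) :=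
  hf.sum_mixedLaw_nonneg (fun i => tripleDomination_dirac (hid i) (hm i))
    (fun i => ae_straddleLaw (hI i).measurableSet (hν i) (hm i ▸ mean_mem (hI i) (hν i) (hid i)))
    hint

/-! ### From independent random variables to product laws. -/

section Mixed

variable {d : ℕ} {μ ν : Fin d → Measure ℝ} {Ω : Finset (Fin d) → Type*}
  [∀ A, MeasurableSpace (Ω A)] {P : ∀ A, Measure (Ω A)}
  {Z : ∀ A, Fin d → Ω A → ℝ}

theorem IsMixedFamily.hasLaw {A : Finset (Fin d)} (h : IsMixedFamily μ ν A (P A) (Z A))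
    (i : Fin d) : HasLaw (Z A i) (mixedLaw μ ν A i) (P A) := by
  unfold mixedLaw
  split_ifs with hi
  exacts [h.law_mem i hi, h.law_not_mem i hi]

theorem IsMixedFamily.aemeasurable {A : Finset (Fin d)} (h : IsMixedFamily μ ν A (P A) (Z A)) :
    AEMeasurable (fun ω i => Z A i ω) (P A) :=
  aemeasurable_pi_lambda _ fun i => (h.hasLaw i).aemeasurable

theorem IsMixedFamily.map_eq {A : Finset (Fin d)} (h : IsMixedFamily μ ν A (P A) (Z A)) :
    (P A).map (fun ω i => Z A i ω) = Measure.pi (mixedLaw μ ν A) := by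
  rw [h.indep.map_fun_eq_pi_map fun i => (h.hasLaw i).aemeasurable]
  congr 1
  funext i
  exact (h.hasLaw i).map_eq

theorem IsMixedFamily.integrable_iff {A : Finset (Fin d)} (h : IsMixedFamily μ ν A (P A) (Z A))
    {f : (Fin d → ℝ) → ℝ} (hf : AEStronglyMeasurable f (Measure.pi (mixedLaw μ ν A))) :
    Integrable f (Measure.pi (mixedLaw μ ν A)) ↔ Integrable (fun ω => f fun i => Z A i ω) (P A) := by
  rw [← h.map_eq] at hf ⊢
  exact integrable_map_measure hf h.aemeasurable

theorem alternatingSum_eq (h : ∀ A, IsMixedFamily μ ν A (P A) (Z A)) {f : (Fin d → ℝ) → ℝ}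
    (hf : ∀ A, AEStronglyMeasurable f (Measure.pi (mixedLaw μ ν A))) :
    alternatingSum P Z f =
      ∑ A : Finset (Fin d), (-1) ^ A.card * ∫ y, f y ∂Measure.pi (mixedLaw μ ν A) := by
  refine Finset.sum_congr rfl fun A _ => ?_
  have hA := hf A
  rw [← (h A).map_eq] at hA ⊢
  rw [integral_map (h A).aemeasurable hA]

theorem BoxConvexOn.alternatingSum_nonneg {I : Fin d → Set ℝ} {f : (Fin d → ℝ) → ℝ}
    (hf : BoxConvexOn (fun _ => 2) I f) (hI : ∀ i, (I i).OrdConnected)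
    (hc : ContinuousOn f (Set.univ.pi I)) [∀ i, IsProbabilityMeasure (ν i)] {m : Fin d → ℝ}
    (hν : ∀ i, ∀ᵐ t ∂ν i, t ∈ I i) (hid : ∀ i, Integrable (fun t => t) (ν i))
    (hm : ∀ i, ∫ t, t ∂ν i = m i)
    (hZ : ∀ A, IsMixedFamily (fun i => Measure.dirac (m i)) ν A (P A) (Z A))
    (hint : ∀ A, Integrable (fun ω => f fun i => Z A i ω) (P A)) :
    0 ≤ alternatingSum P Z f := by
  have hmem : ∀ i, m i ∈ I i := fun i => hm i ▸ mean_mem (hI i) (hν i) (hid i)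
  have hmeas := fun A => aestronglyMeasurable_pi_of_continuousOn hI hc
    (ae_mixedLaw (fun i => ae_dirac_mem (hmem i)) hν A)
  rw [alternatingSum_eq hZ hmeas]
  exact hf.jensen hI hν hid hm fun A => ((hZ A).integrable_iff (hmeas A)).2 (hint A)

end Mixed

/-! ### Explicit formulas in dimension three, and discrete laws. -/

theorem ae_mem_Icc_endpointLaw {a b : ℝ} (hab : a ≤ b) :
    ∀ᵐ t ∂endpointLaw a b, t ∈ Set.Icc a b := by
  refine Measure.smul_absolutelyContinuous.ae_le (ae_add_measure_iff.2 ⟨?_, ?_⟩)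
  exacts [ae_dirac_mem ⟨le_rfl, hab⟩, ae_dirac_mem ⟨hab, le_rfl⟩]

theorem ae_mem_Icc_dirac_midpoint {a b : ℝ} (hab : a ≤ b) :
    ∀ᵐ t ∂Measure.dirac ((a + b) / 2), t ∈ Set.Icc a b := by
  refine ae_dirac_mem ⟨?_, ?_⟩ <;> linarith

theorem sum_finset_fin_three (F : Finset (Fin 3) → ℝ) :
    ∑ A, F A = F ∅ + F {0} + F {1} + F {2} + F {1, 2} + F {0, 2} + F {0, 1} + F {0, 1, 2} := by
  have : (Finset.univ : Finset (Finset (Fin 3))) =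
      {∅, {0}, {1}, {2}, {1, 2}, {0, 2}, {0, 1}, {0, 1, 2}} := by decide
  rw [this, Finset.sum_insert (by decide), Finset.sum_insert (by decide),
    Finset.sum_insert (by decide), Finset.sum_insert (by decide), Finset.sum_insert (by decide),
    Finset.sum_insert (by decide), Finset.sum_insert (by decide), Finset.sum_singleton]
  ring

theorem integral_pi_snoc {d : ℕ} (ρ : Fin (d + 1) → Measure ℝ) [∀ i, IsProbabilityMeasure (ρ i)]
    {f : (Fin (d + 1) → ℝ) → ℝ} (hf : Integrable f (Measure.pi ρ)) :
    Integrable (fun y => ∫ t, f (Fin.snoc y t) ∂ρ (Fin.last d))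
      (Measure.pi fun i : Fin d => ρ i.castSucc) ∧
    ∫ y, f y ∂Measure.pi ρ =
      ∫ y, ∫ t, f (Fin.snoc y t) ∂ρ (Fin.last d) ∂Measure.pi fun i : Fin d => ρ i.castSucc := by
  have mp := measurePreserving_snoc ρ
  have hi := mp.integrable_comp_of_integrable hf
  refine ⟨hi.integral_prod_left, ?_⟩
  have hm := hf.aestronglyMeasurable
  rw [← mp.map_eq] at hm ⊢
  rw [integral_map mp.aemeasurable hm]
  exact integral_prod _ hi

theorem integral_pi_three (ρ : Fin 3 → Measure ℝ) [∀ i, IsProbabilityMeasure (ρ i)]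
    {f : (Fin 3 → ℝ) → ℝ} (hf : Integrable f (Measure.pi ρ)) :
    ∫ y, f y ∂Measure.pi ρ = ∫ x, ∫ y, ∫ z, f ![x, y, z] ∂ρ 2 ∂ρ 1 ∂ρ 0 := by
  obtain ⟨h₁, e₁⟩ := integral_pi_snoc ρ hf
  obtain ⟨h₂, e₂⟩ := integral_pi_snoc _ h₁
  obtain ⟨-, e₃⟩ := integral_pi_snoc _ h₂
  rw [e₁, e₂, e₃, Measure.pi_of_empty _ ![], integral_dirac]
  have (x y z : ℝ) : (Fin.snoc (Fin.snoc (Fin.snoc (![] : Fin 0 → ℝ) x : Fin 1 → ℝ) y : Fin 2 → ℝ) z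
      : Fin 3 → ℝ) = ![x, y, z] := by
    funext i
    fin_cases i <;> rfl
  simp only [this]
  rfl

theorem sum_mixedLaw_three (μ ν : Fin 3 → Measure ℝ) [∀ i, IsProbabilityMeasure (μ i)]
    [∀ i, IsProbabilityMeasure (ν i)] {f : (Fin 3 → ℝ) → ℝ}
    (hf : ∀ A, Integrable f (Measure.pi (mixedLaw μ ν A))) :
    ∑ A : Finset (Fin 3), (-1) ^ A.card * ∫ y, f y ∂Measure.pi (mixedLaw μ ν A) =
      (∫ x, ∫ y, ∫ z, f ![x, y, z] ∂ν 2 ∂ν 1 ∂ν 0) - (∫ x, ∫ y, ∫ z, f ![x, y, z] ∂ν 2 ∂ν 1 ∂μ 0)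
      - (∫ x, ∫ y, ∫ z, f ![x, y, z] ∂ν 2 ∂μ 1 ∂ν 0) - (∫ x, ∫ y, ∫ z, f ![x, y, z] ∂μ 2 ∂ν 1 ∂ν 0)
      + (∫ x, ∫ y, ∫ z, f ![x, y, z] ∂μ 2 ∂μ 1 ∂ν 0) + (∫ x, ∫ y, ∫ z, f ![x, y, z] ∂μ 2 ∂ν 1 ∂μ 0)
      + (∫ x, ∫ y, ∫ z, f ![x, y, z] ∂ν 2 ∂μ 1 ∂μ 0)
      - (∫ x, ∫ y, ∫ z, f ![x, y, z] ∂μ 2 ∂μ 1 ∂μ 0) := by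
  simp only [integral_pi_three _ (hf _)]
  rw [sum_finset_fin_three]
  simp [mixedLaw, sub_eq_add_neg, Odd.neg_one_pow (show Odd 3 by decide)]

/-- The law with mass `α i` at `x i`. -/
def discreteLaw {M : ℕ} (x α : Fin M → ℝ) : Measure ℝ :=
  ∑ i, ENNReal.ofReal (α i) • Measure.dirac (x i)

theorem isProbabilityMeasure_discreteLaw {M : ℕ} (x : Fin M → ℝ) {α : Fin M → ℝ}
    (h0 : ∀ i, 0 ≤ α i) (h1 : ∑ i, α i = 1) : IsProbabilityMeasure (discreteLaw x α) := by
  refine ⟨?_⟩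
  simp only [discreteLaw, Measure.coe_finsetSum, Finset.sum_apply, Measure.smul_apply,
    measure_univ, smul_eq_mul, mul_one]
  rw [← ENNReal.ofReal_sum_of_nonneg fun i _ => h0 i, h1, ENNReal.ofReal_one]

theorem integrable_discreteLaw {M : ℕ} (x α : Fin M → ℝ) (φ : ℝ → ℝ) :
    Integrable φ (discreteLaw x α) :=
  integrable_finsetSum_measure.2 fun _ _ =>
    (integrable_dirac enorm_lt_top).smul_measure ENNReal.ofReal_ne_top

theorem integral_discreteLaw {M : ℕ} (x : Fin M → ℝ) {α : Fin M → ℝ} (h0 : ∀ i, 0 ≤ α i)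
    (φ : ℝ → ℝ) : ∫ t, φ t ∂discreteLaw x α = ∑ i, α i * φ (x i) := by
  rw [discreteLaw, integral_finsetSum_measure fun _ _ =>
    (integrable_dirac enorm_lt_top).smul_measure ENNReal.ofReal_ne_top]
  refine Finset.sum_congr rfl fun i _ => ?_
  rw [integral_smul_measure, integral_dirac, ENNReal.toReal_ofReal (h0 i), smul_eq_mul]

theorem ae_discreteLaw {M : ℕ} (x α : Fin M → ℝ) : ∀ᵐ t ∂discreteLaw x α, t ∈ Set.range x := by
  rw [discreteLaw, ← Measure.sum_fintype, Measure.ae_sum_iff]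
  exact fun i => Measure.smul_absolutelyContinuous.ae_le (ae_dirac_mem (Set.mem_range_self i))

/-- Common source of the explicit midpoint inequality (uniform laws) and the discrete Jensen
inequality (finitely supported laws); compact supports make every integrability condition automatic.
-/
theorem BoxConvexOn.jensen_three {I : Fin 3 → Set ℝ} {f : (Fin 3 → ℝ) → ℝ}
    (hf : BoxConvexOn (fun _ => 2) I f) (hI : ∀ i, (I i).OrdConnected)
    (hc : ContinuousOn f (Set.univ.pi I)) {ν : Fin 3 → Measure ℝ}
    [∀ i, IsProbabilityMeasure (ν i)] {m : Fin 3 → ℝ} {K : Fin 3 → Set ℝ}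
    (hK : ∀ i, IsCompact (K i)) (hKI : ∀ i, K i ⊆ I i) (hν : ∀ i, ∀ᵐ t ∂ν i, t ∈ K i)
    (hid : ∀ i, Integrable (fun t => t) (ν i)) (hm : ∀ i, ∫ t, t ∂ν i = m i) :
    0 ≤ (∫ x, ∫ y, ∫ z, f ![x, y, z] ∂ν 2 ∂ν 1 ∂ν 0)
      - (∫ y, ∫ z, f ![m 0, y, z] ∂ν 2 ∂ν 1)
      - (∫ x, ∫ z, f ![x, m 1, z] ∂ν 2 ∂ν 0) - (∫ x, ∫ y, f ![x, y, m 2] ∂ν 1 ∂ν 0)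
      + (∫ x, f ![x, m 1, m 2] ∂ν 0) + (∫ y, f ![m 0, y, m 2] ∂ν 1)
      + (∫ z, f ![m 0, m 1, z] ∂ν 2) - f ![m 0, m 1, m 2] := by
  have hνI : ∀ i, ∀ᵐ t ∂ν i, t ∈ I i := fun i => (hν i).mono fun t ht => hKI i ht
  have hmem : ∀ i, m i ∈ I i := fun i => hm i ▸ mean_mem (hI i) (hνI i) (hid i)
  have hint : ∀ A, Integrable f
      (Measure.pi (mixedLaw (fun i => Measure.dirac (m i)) ν A)) := fun A =>
    -- The mean is adjoined because `K i` need not be convex, for instance when it is finite.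
    integrable_pi_of_isCompact (K := fun i => insert (m i) (K i)) (fun i => (hK i).insert _)
      (fun i => Set.insert_subset (hmem i) (hKI i)) hc
      (ae_mixedLaw (fun i => ae_dirac_mem (Set.mem_insert _ _))
        (fun i => (hν i).mono fun t ht => Set.mem_insert_of_mem _ ht) A)
  have := hf.jensen hI hνI hid hm hint
  rw [sum_mixedLaw_three _ _ hint] at this
  simpa only [integral_dirac] using this

theorem BoxConvexOn.hermite_hadamard_three {I : Fin 3 → Set ℝ} {a₁ b₁ a₂ b₂ a₃ b₃ : ℝ}
    {f : (Fin 3 → ℝ) → ℝ} (hf : BoxConvexOn (fun _ => 2) I f) (hI : ∀ i, (I i).OrdConnected)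
    (hc : ContinuousOn f (Set.univ.pi I)) (ha₁ : a₁ ∈ I 0) (hb₁ : b₁ ∈ I 0) (ha₂ : a₂ ∈ I 1)
    (hb₂ : b₂ ∈ I 1) (ha₃ : a₃ ∈ I 2) (hb₃ : b₃ ∈ I 2) (h₁ : a₁ < b₁) (h₂ : a₂ < b₂)
    (h₃ : a₃ < b₃) :
    0 ≤ 1 / ((b₁ - a₁) * (b₂ - a₂) * (b₃ - a₃)) *
              (∫ x in a₁..b₁, ∫ y in a₂..b₂, ∫ z in a₃..b₃, f ![x, y, z])
          - 1 / ((b₂ - a₂) * (b₃ - a₃)) *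
              (∫ y in a₂..b₂, ∫ z in a₃..b₃, f ![(a₁ + b₁) / 2, y, z])
          - 1 / ((b₁ - a₁) * (b₃ - a₃)) *
              (∫ x in a₁..b₁, ∫ z in a₃..b₃, f ![x, (a₂ + b₂) / 2, z])
          - 1 / ((b₁ - a₁) * (b₂ - a₂)) *
              (∫ x in a₁..b₁, ∫ y in a₂..b₂, f ![x, y, (a₃ + b₃) / 2])
          + 1 / (b₁ - a₁) * (∫ x in a₁..b₁, f ![x, (a₂ + b₂) / 2, (a₃ + b₃) / 2])
          + 1 / (b₂ - a₂) * (∫ y in a₂..b₂, f ![(a₁ + b₁) / 2, y, (a₃ + b₃) / 2])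
          + 1 / (b₃ - a₃) * (∫ z in a₃..b₃, f ![(a₁ + b₁) / 2, (a₂ + b₂) / 2, z])
          - f ![(a₁ + b₁) / 2, (a₂ + b₂) / 2, (a₃ + b₃) / 2] := by
  set a : Fin 3 → ℝ := ![a₁, a₂, a₃] with ha
  set b : Fin 3 → ℝ := ![b₁, b₂, b₃] with hb
  have hab : ∀ i, a i < b i := by
    intro i; fin_cases i; exacts [h₁, h₂, h₃]
  have haI : ∀ i, a i ∈ I i := by
    intro i; fin_cases i; exacts [ha₁, ha₂, ha₃]
  have hbI : ∀ i, b i ∈ I i := by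
    intro i; fin_cases i; exacts [hb₁, hb₂, hb₃]
  have := fun i => isProbabilityMeasure_uniformLaw (hab i)
  have key := hf.jensen_three hI hc (ν := fun i => uniformLaw (a i) (b i))
    (K := fun i => Set.Icc (a i) (b i)) (fun i => isCompact_Icc)
    (fun i => (hI i).out (haI i) (hbI i)) (fun i => ae_mem_Icc_uniformLaw _ _)
    (fun i => integrable_id_uniformLaw _ _) fun i => integral_id_uniformLaw (hab i)
  simp only [uniformLaw_integral (hab _), intervalIntegral.integral_const_mul] at key
  refine key.trans_eq ?_
  simp only [ha, hb, Matrix.cons_val_zero, Matrix.cons_val_one, Matrix.cons_val, one_div, mul_inv]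
  ring

theorem BoxConvexOn.jensen_three_discrete {I : Fin 3 → Set ℝ} {f : (Fin 3 → ℝ) → ℝ}
    (hf : BoxConvexOn (fun _ => 2) I f) (hI : ∀ i, (I i).OrdConnected)
    (hc : ContinuousOn f (Set.univ.pi I)) {M N L : ℕ}
    {x α : Fin M → ℝ} {y β : Fin N → ℝ} {z γ : Fin L → ℝ} {mx my mz : ℝ}
    (hx : ∀ i, x i ∈ I 0) (hy : ∀ j, y j ∈ I 1) (hz : ∀ k, z k ∈ I 2)
    (hα : ∀ i, 0 ≤ α i) (hβ : ∀ j, 0 ≤ β j) (hγ : ∀ k, 0 ≤ γ k)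
    (sα : ∑ i, α i = 1) (sβ : ∑ j, β j = 1) (sγ : ∑ k, γ k = 1)
    (hmx : mx = ∑ i, α i * x i) (hmy : my = ∑ j, β j * y j) (hmz : mz = ∑ k, γ k * z k) :
    0 ≤ (∑ i, ∑ j, ∑ k, α i * β j * γ k * f ![x i, y j, z k])
          - (∑ j, ∑ k, β j * γ k * f ![mx, y j, z k])
          - (∑ i, ∑ k, α i * γ k * f ![x i, my, z k])
          - (∑ i, ∑ j, α i * β j * f ![x i, y j, mz])
          + (∑ i, α i * f ![x i, my, mz]) + (∑ j, β j * f ![mx, y j, mz])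
          + (∑ k, γ k * f ![mx, my, z k]) - f ![mx, my, mz] := by
  set ν : Fin 3 → Measure ℝ := ![discreteLaw x α, discreteLaw y β, discreteLaw z γ] with hν
  have : ∀ i, IsProbabilityMeasure (ν i) := by
    intro i; fin_cases i
    exacts [isProbabilityMeasure_discreteLaw x hα sα, isProbabilityMeasure_discreteLaw y hβ sβ,
      isProbabilityMeasure_discreteLaw z hγ sγ]
  have key := hf.jensen_three hI hc (ν := ν) (m := ![mx, my, mz])
    (K := ![Set.range x, Set.range y, Set.range z])
    (by
      intro i; fin_cases i
      exacts [(Set.finite_range x).isCompact, (Set.finite_range y).isCompact,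
        (Set.finite_range z).isCompact])
    (by
      intro i; fin_cases i
      exacts [Set.range_subset_iff.2 hx, Set.range_subset_iff.2 hy, Set.range_subset_iff.2 hz])
    (by
      intro i; fin_cases i
      exacts [ae_discreteLaw x α, ae_discreteLaw y β, ae_discreteLaw z γ])
    (by
      intro i; fin_cases i
      exacts [integrable_discreteLaw x α _, integrable_discreteLaw y β _,
        integrable_discreteLaw z γ _])
    (by
      intro i; fin_cases i
      exacts [(integral_discreteLaw x hα _).trans hmx.symm,
        (integral_discreteLaw y hβ _).trans hmy.symm, (integral_discreteLaw z hγ _).trans hmz.symm])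
  simp only [hν, Matrix.cons_val_zero, Matrix.cons_val_one, Matrix.cons_val,
    integral_discreteLaw x hα, integral_discreteLaw y hβ, integral_discreteLaw z hγ,
    Finset.mul_sum, ← mul_assoc] at key
  exact key

theorem BoxConvexOn.jensen_three_independent {I : Fin 3 → Set ℝ} {f : (Fin 3 → ℝ) → ℝ}
    (hf : BoxConvexOn (fun _ => 2) I f) (hI : ∀ i, (I i).OrdConnected)
    (hc : ContinuousOn f (Set.univ.pi I)) {Ω : Type*} [MeasurableSpace Ω] {P : Measure Ω}
    [IsProbabilityMeasure P] {W : Fin 3 → Ω → ℝ} {m : Fin 3 → ℝ} (hW : ∀ i, Measurable (W i))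
    (hWI : ∀ i ω, W i ω ∈ I i) (hWint : ∀ i, Integrable (W i) P) (hind : iIndepFun W P)
    (hm : ∀ i, ∫ ω, W i ω ∂P = m i)
    (hint : ∀ A : Finset (Fin 3),
      Integrable (fun ω => f fun i => if i ∈ A then m i else W i ω) P) :
    0 ≤ ∑ A : Finset (Fin 3),
      (-1) ^ A.card * ∫ ω, f (fun i => if i ∈ A then m i else W i ω) ∂P := by
  have := fun i => Measure.isProbabilityMeasure_map (μ := P) (hW i).aemeasurable
  refine hf.alternatingSum_nonneg (Ω := fun _ => Ω) (P := fun _ => P)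
    (Z := fun A i ω => if i ∈ A then m i else W i ω) (ν := fun i => P.map (W i)) (m := m) hI hc
    (fun i => (ae_map_iff (hW i).aemeasurable (hI i).measurableSet).2
      (Filter.Eventually.of_forall (hWI i)))
    (fun i => (integrable_map_measure aestronglyMeasurable_id (hW i).aemeasurable).2 (hWint i))
    (fun i => (integral_map (hW i).aemeasurable aestronglyMeasurable_id).trans (hm i))
    (fun A => ⟨?_, fun i hi => ?_, fun i hi => ?_⟩) hint
  -- Replacing some coordinates by constants applies a function to each coordinate separately, which
  -- preserves independence.
  · refine (hind.comp (fun i t => if i ∈ A then m i else t) fun i => ?_)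
    by_cases hi : i ∈ A <;> simp only [hi, if_true, if_false] <;> fun_prop
  · simp only [hi, if_true]
    exact ⟨by fun_prop, by simp [Measure.map_const]⟩
  · simp only [hi, if_false]
    exact ⟨(hW i).aemeasurable, rfl⟩

/-- Covers both Hermite–Hadamard cases: all laws live on the compact box `∏ [a i, b i]`, where `f`
is continuous, so integrability is free. -/
theorem BoxConvexOn.hermite_hadamard {d : ℕ} {I : Fin d → Set ℝ} {a b : Fin d → ℝ}
    {f : (Fin d → ℝ) → ℝ} (hf : BoxConvexOn (fun _ => 2) I f)
    (hI : ∀ i, (I i).OrdConnected) (hc : ContinuousOn f (Set.univ.pi I))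
    {Ω : Finset (Fin d) → Type*} [∀ A, MeasurableSpace (Ω A)]
    {P : ∀ A, Measure (Ω A)} {Z : ∀ A, Fin d → Ω A → ℝ}
    (ha : ∀ i, a i ∈ I i) (hb : ∀ i, b i ∈ I i) {μ ν : Fin d → Measure ℝ}
    [∀ i, IsProbabilityMeasure (μ i)] [∀ i, IsProbabilityMeasure (ν i)]
    (hμ : ∀ i, ∀ᵐ t ∂μ i, t ∈ Set.Icc (a i) (b i)) (hν : ∀ i, ∀ᵐ t ∂ν i, t ∈ Set.Icc (a i) (b i))
    {τ : Fin d → Measure (Fin 3 → ℝ)} [∀ i, IsFiniteMeasure (τ i)]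
    (h : ∀ i, TripleDomination (μ i) (ν i) (τ i))
    (hτ : ∀ i, ∀ᵐ x ∂τ i, x ∈ {x : Fin 3 → ℝ | (∀ j, x j ∈ I i) ∧ Function.Injective x})
    (hZ : ∀ A, IsMixedFamily μ ν A (P A) (Z A)) :
    (∀ A, Integrable (fun ω => f fun i => Z A i ω) (P A)) ∧ 0 ≤ alternatingSum P Z f := by
  have hint : ∀ A, Integrable f (Measure.pi (mixedLaw μ ν A)) := fun A =>
    integrable_pi_of_isCompact (fun i => isCompact_Icc) (fun i => (hI i).out (ha i) (hb i)) hc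
      (ae_mixedLaw hμ hν A)
  have hmeas := fun A => (hint A).aestronglyMeasurable
  refine ⟨fun A => ((hZ A).integrable_iff (hmeas A)).1 (hint A), ?_⟩
  rw [alternatingSum_eq hZ hmeas]
  exact hf.sum_mixedLaw_nonneg h hτ hint

end

/-! ### Assembly of the five statements. -/

theorem mainTheorem11 :
    -- The first and the second Hermite-Hadamard inequality in dimension `d`.
    (∀ (d : ℕ) (I : Fin d → Set ℝ) (a b : Fin d → ℝ) (f : (Fin d → ℝ) → ℝ)
      (Ω : Finset (Fin d) → Type*) [∀ A, MeasurableSpace (Ω A)]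
      (P : ∀ A, Measure (Ω A)) [∀ A, IsProbabilityMeasure (P A)] (Z : ∀ A, Fin d → Ω A → ℝ),
      (∀ i, (I i).OrdConnected) → (∀ i, a i ∈ I i) → (∀ i, b i ∈ I i) → (∀ i, a i < b i) →
      ContinuousOn f (Set.univ.pi I) → BoxConvexOn (fun _ => 2) I f →
      ((∀ A, IsMixedFamily (fun i => Measure.dirac ((a i + b i) / 2))
            (fun i => uniformLaw (a i) (b i)) A (P A) (Z A)) →
          (∀ A, Integrable (fun ω => f (fun i => Z A i ω)) (P A)) ∧
          0 ≤ alternatingSum P Z f) ∧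
      ((∀ A, IsMixedFamily (fun i => uniformLaw (a i) (b i))
            (fun i => endpointLaw (a i) (b i)) A (P A) (Z A)) →
          (∀ A, Integrable (fun ω => f (fun i => Z A i ω)) (P A)) ∧
          0 ≤ alternatingSum P Z f)) ∧
    -- The explicit first Hermite-Hadamard inequality for `d = 3`.
    (∀ (I : Fin 3 → Set ℝ) (a₁ b₁ a₂ b₂ a₃ b₃ : ℝ) (f : (Fin 3 → ℝ) → ℝ),
      (∀ i, (I i).OrdConnected) → a₁ ∈ I 0 → b₁ ∈ I 0 → a₂ ∈ I 1 → b₂ ∈ I 1 →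
      a₃ ∈ I 2 → b₃ ∈ I 2 → a₁ < b₁ → a₂ < b₂ → a₃ < b₃ →
      ContinuousOn f (Set.univ.pi I) → BoxConvexOn (fun _ => 2) I f →
      0 ≤ 1 / ((b₁ - a₁) * (b₂ - a₂) * (b₃ - a₃)) *
              (∫ x in a₁..b₁, ∫ y in a₂..b₂, ∫ z in a₃..b₃, f ![x, y, z])
          - 1 / ((b₂ - a₂) * (b₃ - a₃)) *
              (∫ y in a₂..b₂, ∫ z in a₃..b₃, f ![(a₁ + b₁) / 2, y, z])
          - 1 / ((b₁ - a₁) * (b₃ - a₃)) *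
              (∫ x in a₁..b₁, ∫ z in a₃..b₃, f ![x, (a₂ + b₂) / 2, z])
          - 1 / ((b₁ - a₁) * (b₂ - a₂)) *
              (∫ x in a₁..b₁, ∫ y in a₂..b₂, f ![x, y, (a₃ + b₃) / 2])
          + 1 / (b₁ - a₁) * (∫ x in a₁..b₁, f ![x, (a₂ + b₂) / 2, (a₃ + b₃) / 2])
          + 1 / (b₂ - a₂) * (∫ y in a₂..b₂, f ![(a₁ + b₁) / 2, y, (a₃ + b₃) / 2])
          + 1 / (b₃ - a₃) * (∫ z in a₃..b₃, f ![(a₁ + b₁) / 2, (a₂ + b₂) / 2, z])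
          - f ![(a₁ + b₁) / 2, (a₂ + b₂) / 2, (a₃ + b₃) / 2]) ∧
    -- The Jensen inequality in dimension `d`.
    (∀ (d : ℕ) (I : Fin d → Set ℝ) (f : (Fin d → ℝ) → ℝ)
      (Ω' : Fin d → Type*) [∀ i, MeasurableSpace (Ω' i)]
      (Q : ∀ i, Measure (Ω' i)) [∀ i, IsProbabilityMeasure (Q i)] (X : ∀ i, Ω' i → ℝ)
      (Ω : Finset (Fin d) → Type*) [∀ A, MeasurableSpace (Ω A)]
      (P : ∀ A, Measure (Ω A)) [∀ A, IsProbabilityMeasure (P A)] (Z : ∀ A, Fin d → Ω A → ℝ),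
      (∀ i, (I i).OrdConnected) → (∀ i, Measurable (X i)) → (∀ i ω, X i ω ∈ I i) →
      (∀ i, Integrable (X i) (Q i)) →
      ContinuousOn f (Set.univ.pi I) → BoxConvexOn (fun _ => 2) I f →
      (∀ A, IsMixedFamily (fun i => Measure.dirac (∫ ω, X i ω ∂(Q i)))
        (fun i => (Q i).map (X i)) A (P A) (Z A)) →
      (∀ A, Integrable (fun ω => f (fun i => Z A i ω)) (P A)) →
      0 ≤ alternatingSum P Z f) ∧
    -- The explicit Jensen inequality for `d = 3`.
    (∀ (I : Fin 3 → Set ℝ) (f : (Fin 3 → ℝ) → ℝ)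
      (Ω : Type*) [MeasurableSpace Ω] (P : Measure Ω) [IsProbabilityMeasure P]
      (X Y Z : Ω → ℝ) (mX mY mZ : ℝ),
      (∀ i, (I i).OrdConnected) → Measurable X → Measurable Y → Measurable Z →
      (∀ ω, X ω ∈ I 0) → (∀ ω, Y ω ∈ I 1) → (∀ ω, Z ω ∈ I 2) →
      Integrable X P → Integrable Y P → Integrable Z P → iIndepFun ![X, Y, Z] P →
      mX = ∫ ω, X ω ∂P → mY = ∫ ω, Y ω ∂P → mZ = ∫ ω, Z ω ∂P →
      ContinuousOn f (Set.univ.pi I) → BoxConvexOn (fun _ => 2) I f →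
      Integrable (fun ω => f ![X ω, Y ω, Z ω]) P →
      Integrable (fun ω => f ![mX, Y ω, Z ω]) P →
      Integrable (fun ω => f ![X ω, mY, Z ω]) P →
      Integrable (fun ω => f ![X ω, Y ω, mZ]) P →
      Integrable (fun ω => f ![X ω, mY, mZ]) P →
      Integrable (fun ω => f ![mX, Y ω, mZ]) P →
      Integrable (fun ω => f ![mX, mY, Z ω]) P →
      0 ≤ (∫ ω, f ![X ω, Y ω, Z ω] ∂P)
          - (∫ ω, f ![mX, Y ω, Z ω] ∂P) - (∫ ω, f ![X ω, mY, Z ω] ∂P)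
          - (∫ ω, f ![X ω, Y ω, mZ] ∂P)
          + (∫ ω, f ![X ω, mY, mZ] ∂P) + (∫ ω, f ![mX, Y ω, mZ] ∂P)
          + (∫ ω, f ![mX, mY, Z ω] ∂P) - f ![mX, mY, mZ]) ∧
    -- The discrete Jensen inequality for `d = 3`.
    (∀ (I : Fin 3 → Set ℝ) (f : (Fin 3 → ℝ) → ℝ) (M N L : ℕ)
      (x α : Fin M → ℝ) (y β : Fin N → ℝ) (z γ : Fin L → ℝ) (mx my mz : ℝ),
      (∀ i, (I i).OrdConnected) → 1 < M → 1 < N → 1 < L →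
      (∀ i, x i ∈ I 0) → (∀ j, y j ∈ I 1) → (∀ k, z k ∈ I 2) →
      (∀ i, 0 ≤ α i) → (∀ j, 0 ≤ β j) → (∀ k, 0 ≤ γ k) →
      ∑ i, α i = 1 → ∑ j, β j = 1 → ∑ k, γ k = 1 →
      mx = ∑ i, α i * x i → my = ∑ j, β j * y j → mz = ∑ k, γ k * z k →
      ContinuousOn f (Set.univ.pi I) → BoxConvexOn (fun _ => 2) I f →
      0 ≤ (∑ i, ∑ j, ∑ k, α i * β j * γ k * f ![x i, y j, z k])
          - (∑ j, ∑ k, β j * γ k * f ![mx, y j, z k])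
          - (∑ i, ∑ k, α i * γ k * f ![x i, my, z k])
          - (∑ i, ∑ j, α i * β j * f ![x i, y j, mz])
          + (∑ i, α i * f ![x i, my, mz]) + (∑ j, β j * f ![mx, y j, mz])
          + (∑ k, γ k * f ![mx, my, z k]) - f ![mx, my, mz]) := by
  refine ⟨?_, ?_, ?_, ?_, ?_⟩
  · intro d I a b f Ω _ P _ Z hI ha hb hab hc hf
    have hu := fun i => isProbabilityMeasure_uniformLaw (hab i)
    have hchord : ∀ i, IsFiniteMeasure (chordLaw (a i) (b i)) := fun i => by
      unfold chordLaw; infer_instance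
    refine ⟨fun hZ => ?_, fun hZ => ?_⟩
    · refine hf.hermite_hadamard hI hc ha hb
        (fun i => ae_mem_Icc_dirac_midpoint (hab i).le) (fun i => ae_mem_Icc_uniformLaw _ _)
        (fun i => tripleDomination_dirac (integrable_id_uniformLaw _ _)
          (integral_id_uniformLaw (hab i))) (fun i => ?_) hZ
      have hIcc := (hI i).out (ha i) (hb i)
      refine ae_straddleLaw (hI i).measurableSet
        ((ae_mem_Icc_uniformLaw _ _).mono fun t ht => hIcc ht) (hIcc ?_)
      have := hab i
      constructor <;> linarith
    · exact hf.hermite_hadamard hI hc ha hb (fun i => ae_mem_Icc_uniformLaw _ _)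
        (fun i => ae_mem_Icc_endpointLaw (hab i).le)
        (fun i => tripleDomination_uniformLaw (hab i))
        (fun i => ae_chordLaw (hI i) (ha i) (hb i)) hZ
  · intro I a₁ b₁ a₂ b₂ a₃ b₃ f hI ha₁ hb₁ ha₂ hb₂ ha₃ hb₃ h₁ h₂ h₃ hc hf
    exact hf.hermite_hadamard_three hI hc ha₁ hb₁ ha₂ hb₂ ha₃ hb₃ h₁ h₂ h₃
  · intro d I f Ω' _ Q _ X Ω _ P _ Z hI hX hXI hXint hc hf hZ hint
    have := fun i => Measure.isProbabilityMeasure_map (μ := Q i) (hX i).aemeasurable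
    exact hf.alternatingSum_nonneg hI hc
      (fun i => (ae_map_iff (hX i).aemeasurable (hI i).measurableSet).2
        (Filter.Eventually.of_forall (hXI i)))
      (fun i => (integrable_map_measure aestronglyMeasurable_id (hX i).aemeasurable).2 (hXint i))
      (fun i => integral_map (hX i).aemeasurable aestronglyMeasurable_id) hZ hint
  · intro I f Ω _ P _ X Y Z mX mY mZ hI hX hY hZ hXI hYI hZI iX iY iZ hind hmX hmY hmZ hc hf
      h h₀ h₁ h₂ h₁₂ h₀₂ h₀₁
    have hA : ∀ A : Finset (Fin 3),
        (fun ω => f fun i => if i ∈ A then ![mX, mY, mZ] i else ![X, Y, Z] i ω) =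
        fun ω => f ![if 0 ∈ A then mX else X ω, if 1 ∈ A then mY else Y ω,
          if 2 ∈ A then mZ else Z ω] := by
      intro A
      funext ω
      congr 1
      funext i
      fin_cases i <;> rfl
    have key := hf.jensen_three_independent hI hc (W := ![X, Y, Z]) (m := ![mX, mY, mZ])
      (by intro i; fin_cases i; exacts [hX, hY, hZ])
      (by intro i; fin_cases i; exacts [hXI, hYI, hZI])
      (by intro i; fin_cases i; exacts [iX, iY, iZ]) hind
      (by intro i; fin_cases i; exacts [hmX.symm, hmY.symm, hmZ.symm])
      (by
        intro A
        rw [hA]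
        -- Seven of the eight cases are the integrability hypotheses; the full set gives a constant.
        by_cases m₀ : 0 ∈ A <;> by_cases m₁ : 1 ∈ A <;> by_cases m₂ : 2 ∈ A <;>
          simp only [m₀, m₁, m₂, if_true, if_false] <;>
          first | assumption | exact integrable_const _)
    simp only [hA] at key
    rw [sum_finset_fin_three] at key
    refine key.trans_eq ?_
    simp [sub_eq_add_neg, Odd.neg_one_pow (show Odd 3 by decide)]
  · intro I f M N L x α y β z γ mx my mz hI _ _ _ hx hy hz hα hβ hγ sα sβ sγ hmx hmy hmz hc hf
    exact hf.jensen_three_discrete hI hc hx hy hz hα hβ hγ sα sβ sγ hmx hmy hmz
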